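/- \textbf{Conventions.} Let $p$ be a prime and $F$ a field of characteristic $p$. Let $J_k=I_k+N_k$ be the $k\times k$ unipotent Jordan block over $F$, where $N_k$ has entries $1$ in the positions $(i,i+1)$ and $0$ elsewhere. For $1\le r\le s$, the Jordan canonical form of $J_r\otimes J_s$ is $J_{\lambda_1}\oplus\cdots\oplus J_{\lambda_r}$ with $\lambda_1\ge\cdots\ge\lambda_r>0$, where the $\lambda_n$ depend only on $r,s,p$; the Norman permutation $\pi(r,s,p)$ of $[r]=\{1,\dots,r\}$ is $n\mapsto (r+1-n)+s-\lambda_n$. For $1\le i\le j\le r$, let $\mathrm{Rev}(i,j)$ be the permutation of $[r]$ that sends $n$ to $i+j-n$ if $i\le n\le j$ and fixes all other points. For $1\le k\le p^N$, let $V_k$ be the indecomposable $k$-dimensional module over $F$ for the cyclic group $C_{p^N}$ of order $p^N$, on which a fixed generator acts as $J_k$. The Green ring of $C_{p^N}$ over $F$ is generated additively by the isomorphism classes of finite-dimensional modules, with $[V]+[W]=[V\oplus W]$ and $[V][W]=[V\otimes W]$. \textbf{Proposition.} Let $r$ be a positive integer whose $p$-part (the largest power of $p$ dividing $r$) is $b$,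 where $1<b<r$, and let $m$ be such that $r\le p^m$. Then \begin{align*} \pi(r,p^m+b,p)&=\mathrm{Rev}(1,b)\,\mathrm{Rev}(b+1,r),\\ \pi(r,p^m+2b,p)&=\mathrm{Rev}(1,b)\,\mathrm{Rev}(b+1,2b)\,\mathrm{Rev}(2b+1,r)\qquad\text{if } 2b<r,\\ \pi(r,p^m+b+1,p)&=\mathrm{Rev}(2,b)\,\mathrm{Rev}(b+2,r). \end{align*} Moreover, for every $N$ with $p^m+r+b\le p^N$, in the Green ring of $C_{p^N}$ over $F$, \[ V_r\otimes V_{p^m+b+1}=V_{p^m+r+b}\oplus(b-1)V_{p^m+r}\oplus V_{p^m+r-b}\oplus(r-b-1)V_{p^m}, \] where $cV$ denotes the direct sum of $c$ copies of $V$. -/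

import Mathlib

open CategoryTheory MonoidalCategory
open scoped Kronecker

/-- The nilpotent Jordan block `N_k`: the `k × k` matrix with `1` in the entries `(i, i + 1)`
and zeros elsewhere. -/
def nilBlock (F : Type*) [Field F] (k : ℕ) : Matrix (Fin k) (Fin k) F :=
  Matrix.of fun i j => if (j : ℕ) = i + 1 then 1 else 0

/-- The unipotent Jordan block `J_k = I_k + N_k`. -/
def jordanBlock (F : Type*) [Field F] (k : ℕ) : Matrix (Fin k) (Fin k) F :=
  1 + nilBlock F k

/-- Similarity of square matrices whose index sets may differ: `P⁻¹ A P = B` for some invertible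
`P` with inverse `Q`. -/
def MatrixSimilar {F : Type*} [Field F] {m n : Type*} [Fintype m] [DecidableEq m]
    [Fintype n] [DecidableEq n] (A : Matrix m m F) (B : Matrix n n F) : Prop :=
  ∃ (P : Matrix m n F) (Q : Matrix n m F), P * Q = 1 ∧ Q * P = 1 ∧ Q * A * P = B

/-- `lam` is a list of `r` positive parts, in weakly decreasing order and indexed by
`[r] = {1, …, r}`, such that the Jordan canonical form of `J_r ⊗ J_s` over `F` is
`J_{lam 1} ⊕ ⋯ ⊕ J_{lam r}`. -/
def IsJordanPartition (F : Type*) [Field F] (r s : ℕ) (lam : Finset.Icc 1 r → ℕ) : Prop :=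
  Antitone lam ∧ (∀ n, 0 < lam n) ∧
    MatrixSimilar (jordanBlock F r ⊗ₖ jordanBlock F s)
      (Matrix.blockDiagonal' fun n => jordanBlock F (lam n))

/-- The Jordan partition `λ(r, s, F)`, with `1 ≤ r ≤ s`. -/
noncomputable def jordanPartition (F : Type*) [Field F] (r s : ℕ) : Finset.Icc 1 r → ℕ :=
  Classical.epsilon (IsJordanPartition F r s)

/-- The Norman permutation `π(r, s, F)` of `[r]`, that is `n ↦ (r + 1 - n) + s - λ_n`. -/
noncomputable def normanPerm (F : Type*) [Field F] (r s : ℕ) : Equiv.Perm (Finset.Icc 1 r) :=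
  Classical.epsilon fun σ : Equiv.Perm (Finset.Icc 1 r) =>
    ∀ n, ((σ n : ℕ) : ℤ) = ((r : ℤ) + 1 - (n : ℕ)) + s - jordanPartition F r s n

/-- The map underlying the reversal `Rev(i, j)`: it sends `n` to `i + j - n` for `i ≤ n ≤ j` and
fixes all other points (it is the identity map unless `1 ≤ i` and `j ≤ r`). -/
def revFun (r i j : ℕ) (n : Finset.Icc 1 r) : Finset.Icc 1 r :=
  if h : 1 ≤ i ∧ j ≤ r ∧ i ≤ (n : ℕ) ∧ (n : ℕ) ≤ j then
    ⟨i + j - n, Finset.mem_Icc.2 (by omega)⟩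
  else n

theorem revFun_involutive (r i j : ℕ) : Function.Involutive (revFun r i j) := by
  intro n
  apply Subtype.ext
  unfold revFun
  split_ifs with h1 h2
  · simp only
    omega
  · exact absurd (by simp only; omega) h2
  · rfl

/-- The reversal permutation `Rev(i, j)` of `[r]`, for `1 ≤ i ≤ j ≤ r`. -/
def Rev (r i j : ℕ) : Equiv.Perm (Finset.Icc 1 r) :=
  (revFun_involutive r i j).toPerm

theorem nilBlock_pow_apply (F : Type*) [Field F] (k t : ℕ) (i j : Fin k) :
    (nilBlock F k ^ t) i j = if (j : ℕ) = i + t then 1 else 0 := by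
  induction t generalizing j with
  | zero => simp [Matrix.one_apply, Fin.ext_iff, eq_comm]
  | succ t ih =>
    rw [pow_succ, Matrix.mul_apply]
    simp only [ih]
    have hN (l : Fin k) : nilBlock F k l j = if (j : ℕ) = l + 1 then 1 else 0 := rfl
    simp only [hN]
    by_cases h : (j : ℕ) = i + (t + 1)
    · have hlt : (i : ℕ) + t < k := by have := j.isLt; omega
      rw [if_pos h, Finset.sum_eq_single ⟨(i : ℕ) + t, hlt⟩]
      · rw [if_pos rfl, if_pos (by simp only; omega), mul_one]
      · intro l _ hl
        rw [if_neg (fun e => hl (Fin.ext e)), zero_mul]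
      · simp
    · rw [if_neg h]
      refine Finset.sum_eq_zero fun l _ => ?_
      by_cases h1 : (l : ℕ) = i + t
      · rw [if_neg (show ¬ (j : ℕ) = l + 1 by omega), mul_zero]
      · rw [if_neg h1, zero_mul]

/-- In characteristic `p` the block `J_k` satisfies `J_k ^ (p ^ N) = 1` once `k ≤ p ^ N`. -/
theorem jordanBlock_pow (F : Type*) [Field F] {p : ℕ} [Fact p.Prime] [CharP F p] {N k : ℕ}
    (hk : k ≤ p ^ N) : jordanBlock F k ^ p ^ N = 1 := by
  have hnil : nilBlock F k ^ p ^ N = 0 := by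
    ext i j
    rw [nilBlock_pow_apply, if_neg (by omega)]
    rfl
  rcases Nat.eq_zero_or_pos k with rfl | hpos
  · exact Subsingleton.elim _ _
  · have : Nonempty (Fin k) := ⟨⟨0, hpos⟩⟩
    rw [jordanBlock, add_pow_char_pow_of_commute (p := p) _ (Commute.one_left _), one_pow, hnil, add_zero]

/-- For a matrix `A` with `A ^ q = 1`, the representation of the cyclic group of order `q` in which
the standard generator acts on column vectors as `A`. -/
def cyclicRep {F : Type*} [Field F] {n : Type*} [Fintype n] [DecidableEq n] {q : ℕ} [NeZero q]
    (A : Matrix n n F) (hA : A ^ q = 1) : Representation F (Multiplicative (ZMod q)) (n → F) where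
  toFun g := Matrix.toLin' (A ^ (Multiplicative.toAdd g).val)
  map_one' := by simp [Module.End.one_eq_id]
  map_mul' g h := by
    rw [toAdd_mul, ZMod.val_add, ← pow_eq_pow_mod _ hA, pow_add, Matrix.toLin'_mul]
    rfl

/-- The indecomposable module `V_k`, for `k ≤ p ^ N`: the module of dimension `k` over a field `F`
of characteristic `p` for the cyclic group of order `p ^ N` whose standard generator acts
as `J_k`. -/
noncomputable def jordanRep (F : Type*) [Field F] {p : ℕ} [Fact p.Prime] [CharP F p] {N : ℕ}
    (k : ℕ) (hk : k ≤ p ^ N) : FDRep F (Multiplicative (ZMod (p ^ N))) :=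
  FDRep.of (cyclicRep (jordanBlock F k) (jordanBlock_pow F hk))

/-- The ideal generated by the elements `[V ⊕ W] - [V] - [W]` in the ring on the free abelian group
of isomorphism classes of finite-dimensional representations, where `[V] * [W] = [V ⊗ W]`. -/
noncomputable def greenIdeal (F G : Type*) [Field F] [Group G] :
    Ideal (MonoidAlgebra ℤ (Skeleton (FDRep F G))) :=
  Ideal.span {x | ∃ (V W : FDRep F G) (B : Limits.BinaryBicone V W), Nonempty B.IsBilimit ∧
    x = MonoidAlgebra.of ℤ _ (toSkeleton B.pt)
      - MonoidAlgebra.of ℤ _ (toSkeleton V) - MonoidAlgebra.of ℤ _ (toSkeleton W)}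

/-- The Green ring (representation ring) of `G` over `F`: isomorphism classes of finite-dimensional
representations, addition induced by direct sums and multiplication by tensor products. -/
abbrev GreenRing (F G : Type*) [Field F] [Group G] : Type _ :=
  MonoidAlgebra ℤ (Skeleton (FDRep F G)) ⧸ greenIdeal F G

/-- The class of a representation in the Green ring. -/
noncomputable def greenClass {F G : Type*} [Field F] [Group G] (V : FDRep F G) : GreenRing F G :=
  Ideal.Quotient.mk (greenIdeal F G) (MonoidAlgebra.of ℤ _ (toSkeleton V))

/-!
Write `J_r ⊗ J_s - 1 = x + y` with `x = N_r ⊗ 1` and `y = J_r ⊗ N_s`: these commute,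
`x ^ r = y ^ s = 0`, and `F ^ r ⊗ F ^ s` is the cyclic module `F[x, y] / (x ^ r, y ^ s)`. Suppose
that for each `n ∈ [r]` the power `x ^ (n - 1)` has a lift modulo `x + y` that is killed by
`(x + y) ^ λ_n`, and that `∑ λ_n = r s`. By Nakayama's lemma for the nilpotent operator `x + y` the
chains generated by these lifts span, and by the dimension count they form a Jordan basis, so the
`λ_n` are the block sizes. That the block sizes are unique follows from the ranks of the powers of
`x + y`.

Let `q = p ^ m`, `b = p ^ e` and `r = b k ≤ q` with `p ∤ k`. In characteristic `p` one has
`(x + y) ^ q = y ^ q` and `(x + y) ^ (b j) = (x ^ b + y ^ b) ^ j`. Since `(x ^ b) ^ k = 0`,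
expanding the latter for `j = k` and `j = k + 1` shows that `(x + y) ^ (q + r)` and
`(x + y) ^ (q + r + b)` are divisible by `y ^ (q + b)` and `y ^ (q + 2 b)`, so a power of `-y`
serves as the lift. For the exponent `q + r - b` the lift also has to cancel the term of
`(x ^ b + y ^ b) ^ (k - 1)` that is linear in `y ^ b`, and this costs a factor `k`, which is
invertible.
-/

open scoped Matrix

section Similarity

variable {R : Type*} [Semiring R] {F : Type*} [Field F] {l m n : Type*}
  [Fintype l] [DecidableEq l] [Fintype m] [DecidableEq m] [Fintype n] [DecidableEq n]

theorem pow_mul_eq_mul_pow_of_intertwines {A : Matrix m m R} {B : Matrix n n R} {P : Matrix m n R}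
    (h : A * P = P * B) (t : ℕ) : A ^ t * P = P * B ^ t := by
  induction t with
  | zero => rw [pow_zero, pow_zero, Matrix.one_mul, Matrix.mul_one]
  | succ t ih =>
    rw [pow_succ', Matrix.mul_assoc, ih, ← Matrix.mul_assoc, h, Matrix.mul_assoc, ← pow_succ']

theorem matrixSimilar_iff_intertwines {A : Matrix m m F} {B : Matrix n n F} :
    MatrixSimilar A B ↔
      ∃ (P : Matrix m n F) (Q : Matrix n m F), P * Q = 1 ∧ Q * P = 1 ∧ A * P = P * B := by
  refine exists₂_congr fun P Q => and_congr_right fun hPQ => and_congr_right fun hQP => ?_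
  constructor
  · rintro rfl
    rw [Matrix.mul_assoc Q, ← Matrix.mul_assoc P, hPQ, Matrix.one_mul]
  · intro h
    rw [Matrix.mul_assoc, h, ← Matrix.mul_assoc, hQP, Matrix.one_mul]

theorem MatrixSimilar.symm {A : Matrix m m F} {B : Matrix n n F} (h : MatrixSimilar A B) :
    MatrixSimilar B A := by
  obtain ⟨P, Q, hPQ, hQP, hAB⟩ := matrixSimilar_iff_intertwines.1 h
  refine ⟨Q, P, hQP, hPQ, ?_⟩
  rw [← hAB, Matrix.mul_assoc, hPQ, Matrix.mul_one]

theorem MatrixSimilar.trans {A : Matrix l l F} {B : Matrix m m F} {C : Matrix n n F}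
    (hAB : MatrixSimilar A B) (hBC : MatrixSimilar B C) : MatrixSimilar A C := by
  obtain ⟨P, Q, hPQ, hQP, rfl⟩ := hAB
  obtain ⟨P', Q', hPQ', hQP', rfl⟩ := hBC
  refine ⟨P * P', Q' * Q, ?_, ?_, by simp only [Matrix.mul_assoc]⟩
  · rw [Matrix.mul_assoc, ← Matrix.mul_assoc P', hPQ', Matrix.one_mul, hPQ]
  · rw [Matrix.mul_assoc, ← Matrix.mul_assoc Q, hQP, Matrix.one_mul, hQP']

theorem MatrixSimilar.sub_one_pow {A : Matrix m m F} {B : Matrix n n F} (h : MatrixSimilar A B)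
    (t : ℕ) : MatrixSimilar ((A - 1) ^ t) ((B - 1) ^ t) := by
  obtain ⟨P, Q, hPQ, hQP, hAB⟩ := matrixSimilar_iff_intertwines.1 h
  refine matrixSimilar_iff_intertwines.2
    ⟨P, Q, hPQ, hQP, pow_mul_eq_mul_pow_of_intertwines ?_ t⟩
  rw [Matrix.sub_mul, Matrix.mul_sub, hAB, Matrix.one_mul, Matrix.mul_one]

theorem MatrixSimilar.rank_le {A : Matrix m m F} {B : Matrix n n F} (h : MatrixSimilar A B) :
    B.rank ≤ A.rank := by
  obtain ⟨P, Q, -, -, rfl⟩ := h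
  exact (Matrix.rank_mul_le_left _ _).trans (Matrix.rank_mul_le_right _ _)

theorem MatrixSimilar.rank_eq {A : Matrix m m F} {B : Matrix n n F} (h : MatrixSimilar A B) :
    A.rank = B.rank :=
  le_antisymm h.symm.rank_le h.rank_le

end Similarity

section Rank

theorem rank_eq_of_mul_eq_of_mul_eq {R : Type*} [CommRing R] [StrongRankCondition R]
    {l m n : Type*} [Fintype m] [Fintype n] {A : Matrix l m R} {B : Matrix m n R}
    {C : Matrix l n R} {D : Matrix n m R} (hAB : A * B = C) (hCD : C * D = A) :
    A.rank = C.rank :=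
  le_antisymm (hCD ▸ Matrix.rank_mul_le_left C D) (hAB ▸ Matrix.rank_mul_le_left A B)

variable (F : Type*) [Field F]

theorem nilBlock_pow_eq_zero {k t : ℕ} (h : k ≤ t) : nilBlock F k ^ t = 0 := by
  ext i j
  rw [nilBlock_pow_apply, if_neg (by lia), Matrix.zero_apply]

theorem nilBlock_pow_mul_transpose (k t : ℕ) :
    nilBlock F k ^ t * (nilBlock F k ^ t)ᵀ =
      Matrix.diagonal fun i : Fin k => if (i : ℕ) + t < k then 1 else 0 := by
  ext i j
  simp only [Matrix.mul_apply, Matrix.transpose_apply, nilBlock_pow_apply, Matrix.diagonal_apply,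
    ite_mul, one_mul, zero_mul]
  by_cases hi : (i : ℕ) + t < k
  · rw [Finset.sum_eq_single ⟨i + t, hi⟩ (fun l _ hl => if_neg fun h => hl (Fin.ext h)) (by simp)]
    simp [hi, Fin.ext_iff]
  · rw [Finset.sum_eq_zero fun l _ => if_neg (by lia)]
    simp [hi]

theorem nilBlock_pow_mul_transpose_mul (k t : ℕ) :
    nilBlock F k ^ t * (nilBlock F k ^ t)ᵀ * nilBlock F k ^ t = nilBlock F k ^ t := by
  rw [nilBlock_pow_mul_transpose]
  ext i j
  rw [Matrix.diagonal_mul, nilBlock_pow_apply, ite_mul, one_mul, zero_mul, ← ite_and]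
  exact if_congr (by lia) rfl rfl

variable {ι : Type*} [DecidableEq ι]

theorem blockDiagonal'_jordanBlock_sub_one (lam : ι → ℕ) :
    (Matrix.blockDiagonal' fun n => jordanBlock F (lam n)) - 1 =
      Matrix.blockDiagonal' fun n => nilBlock F (lam n) := by
  rw [← Matrix.blockDiagonal'_one, ← Matrix.blockDiagonal'_sub]
  exact congrArg _ (funext fun n => add_sub_cancel_left 1 (nilBlock F (lam n)))

theorem rank_blockDiagonal'_nilBlock_pow [Fintype ι] (lam : ι → ℕ) (t : ℕ) :
    ((Matrix.blockDiagonal' fun n => nilBlock F (lam n)) ^ t).rank = ∑ n, (lam n - t) := by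
  classical
  rw [← Matrix.blockDiagonal'_pow]
  have hmul : Matrix.blockDiagonal' ((fun n => nilBlock F (lam n)) ^ t) *
      Matrix.blockDiagonal' (fun n => (nilBlock F (lam n) ^ t)ᵀ) =
      Matrix.diagonal fun x : Σ n, Fin (lam n) => if (x.2 : ℕ) + t < lam x.1 then 1 else 0 := by
    rw [← Matrix.blockDiagonal'_mul, ← Matrix.blockDiagonal'_diagonal
      (fun (n : ι) (i : Fin (lam n)) => if (i : ℕ) + t < lam n then (1 : F) else 0)]
    exact congrArg _ (funext fun n => nilBlock_pow_mul_transpose F (lam n) t)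
  have hmul' : (Matrix.diagonal fun x : Σ n, Fin (lam n) =>
      if (x.2 : ℕ) + t < lam x.1 then (1 : F) else 0) *
      Matrix.blockDiagonal' ((fun n => nilBlock F (lam n)) ^ t) =
      Matrix.blockDiagonal' ((fun n => nilBlock F (lam n)) ^ t) := by
    rw [← hmul, ← Matrix.blockDiagonal'_mul, ← Matrix.blockDiagonal'_mul]
    exact congrArg _ (funext fun n => nilBlock_pow_mul_transpose_mul F (lam n) t)
  have support_card (n : ι) :
      (Finset.univ.filter fun i : Fin (lam n) => (i : ℕ) + t < lam n).card = lam n - t := by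
    simp only [← Nat.lt_sub_iff_add_lt]
    rw [Fin.card_filter_val_lt, min_eq_right (Nat.sub_le _ _)]
  rw [rank_eq_of_mul_eq_of_mul_eq hmul hmul', Matrix.rank_diagonal, Fintype.card_subtype,
    Finset.card_filter, Fintype.sum_sigma]
  refine Finset.sum_congr rfl fun n _ => ?_
  rw [← support_card, Finset.card_filter]
  simp

end Rank

section Antitone

variable {ι : Type*} [Fintype ι]

theorem sum_tsub_eq_sum_tsub_succ_add_card (f : ι → ℕ) (t : ℕ) :
    ∑ n, (f n - t) = ∑ n, (f n - (t + 1)) + (Finset.univ.filter fun n => t < f n).card := by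
  rw [Finset.card_filter, ← Finset.sum_add_distrib]
  refine Finset.sum_congr rfl fun n _ => ?_
  split_ifs <;> lia

theorem eq_of_isLowerSet_of_card_eq {ι : Type*} [LinearOrder ι] {s t : Finset ι}
    (hs : IsLowerSet (s : Set ι)) (ht : IsLowerSet (t : Set ι)) (hst : s.card = t.card) :
    s = t := by
  rcases hs.total ht with h | h
  · exact Finset.eq_of_subset_of_card_le (Finset.coe_subset.1 h) hst.ge
  · exact (Finset.eq_of_subset_of_card_le (Finset.coe_subset.1 h) hst.le).symm

theorem eq_of_antitone_of_sum_tsub_eq [LinearOrder ι] {f g : ι → ℕ} (hf : Antitone f)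
    (hg : Antitone g) (h : ∀ t, ∑ n, (f n - t) = ∑ n, (g n - t)) : f = g := by
  have superlevel_eq (t : ℕ) :
      (Finset.univ.filter fun n => t < f n) = Finset.univ.filter fun n => t < g n := by
    have isLowerSet_superlevel {f : ι → ℕ} (hf : Antitone f) :
        IsLowerSet ((Finset.univ.filter fun n => t < f n : Finset ι) : Set ι) := by
      intro i j hji hi
      simp only [Finset.coe_filter, Finset.mem_univ, true_and, Set.mem_ofPred_eq] at hi ⊢
      exact hi.trans_le (hf hji)
    refine eq_of_isLowerSet_of_card_eq (isLowerSet_superlevel hf) (isLowerSet_superlevel hg) ?_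
    have hft := sum_tsub_eq_sum_tsub_succ_add_card f t
    rw [h t, h (t + 1), sum_tsub_eq_sum_tsub_succ_add_card g t] at hft
    exact (Nat.add_left_cancel hft).symm
  funext n
  refine eq_of_forall_lt_iff fun t => ?_
  simpa using Finset.ext_iff.1 (superlevel_eq t) n

end Antitone

section JordanPartition

variable {F : Type*} [Field F] {r s : ℕ} {lam : Finset.Icc 1 r → ℕ}

theorem IsJordanPartition.unique {lam' : Finset.Icc 1 r → ℕ} (h : IsJordanPartition F r s lam)
    (h' : IsJordanPartition F r s lam') : lam = lam' := by
  refine eq_of_antitone_of_sum_tsub_eq h.1 h'.1 fun t => ?_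
  have hrank := ((h.2.2.symm.trans h'.2.2).sub_one_pow t).rank_eq
  rwa [blockDiagonal'_jordanBlock_sub_one, blockDiagonal'_jordanBlock_sub_one,
    rank_blockDiagonal'_nilBlock_pow, rank_blockDiagonal'_nilBlock_pow] at hrank

theorem IsJordanPartition.jordanPartition_eq (h : IsJordanPartition F r s lam) :
    jordanPartition F r s = lam :=
  IsJordanPartition.unique (Classical.epsilon_spec (p := IsJordanPartition F r s) ⟨lam, h⟩) h

/-- The relation between a family `lam` of parts and the permutation `σ` of `[r]` that defines
`normanPerm`; it lives in `ℤ` because `s - lam n` may be negative. -/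
def IsNormanPerm {r : ℕ} (s : ℕ) (lam : Finset.Icc 1 r → ℕ) (σ : Equiv.Perm (Finset.Icc 1 r)) :
    Prop :=
  ∀ n, ((σ n : ℕ) : ℤ) = ((r : ℤ) + 1 - (n : ℕ)) + s - lam n

theorem coe_Rev_apply (r i j : ℕ) (n : Finset.Icc 1 r) :
    (Rev r i j n : ℕ) =
      if 1 ≤ i ∧ j ≤ r ∧ i ≤ (n : ℕ) ∧ (n : ℕ) ≤ j then i + j - n else n := by
  change (revFun r i j n : ℕ) = _
  unfold revFun
  split_ifs <;> rfl

theorem IsNormanPerm.unique {σ τ : Equiv.Perm (Finset.Icc 1 r)} (hσ : IsNormanPerm s lam σ)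
    (hτ : IsNormanPerm s lam τ) : σ = τ := by
  ext n
  exact_mod_cast (hσ n).trans (hτ n).symm

theorem IsNormanPerm.sum_eq {σ : Equiv.Perm (Finset.Icc 1 r)} (hσ : IsNormanPerm s lam σ) :
    ∑ n, lam n = r * s := by
  have sum_comp (τ : Equiv.Perm (Finset.Icc 1 r)) :
      ∑ n, ((τ n : ℕ) : ℤ) = ∑ n : Finset.Icc 1 r, ((n : ℕ) : ℤ) :=
    Equiv.sum_comp τ fun n => ((n : ℕ) : ℤ)
  have hlam (n : Finset.Icc 1 r) : (lam n : ℤ) = (Rev r 1 r n : ℕ) - (σ n : ℕ) + s := by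
    rw [hσ n, coe_Rev_apply]
    have := Finset.mem_Icc.1 n.2
    split_ifs <;> lia
  zify
  simp only [hlam, Finset.sum_add_distrib, Finset.sum_sub_distrib, sum_comp, sub_self, zero_add,
    Finset.sum_const, Finset.card_univ, Fintype.card_coe, Nat.card_Icc, Nat.add_sub_cancel,
    nsmul_eq_mul]

theorem IsJordanPartition.normanPerm_eq (h : IsJordanPartition F r s lam)
    {σ : Equiv.Perm (Finset.Icc 1 r)} (hσ : IsNormanPerm s lam σ) : normanPerm F r s = σ := by
  have hex : ∃ τ, IsNormanPerm s (jordanPartition F r s) τ := ⟨σ, by rwa [h.jordanPartition_eq]⟩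
  have hspec : IsNormanPerm s (jordanPartition F r s) (normanPerm F r s) :=
    Classical.epsilon_spec hex
  rw [h.jordanPartition_eq] at hspec
  exact hspec.unique hσ

end JordanPartition

section Nakayama

variable {R V : Type*} [Ring R] [AddCommGroup V] [Module R V]

theorem eq_top_of_sup_range_eq_top_of_isNilpotent {z : Module.End R V} (hz : IsNilpotent z)
    {W : Submodule R V} (hW : W.map z ≤ W) (h : W ⊔ LinearMap.range z = ⊤) : W = ⊤ := by
  have sup_range_pow (t : ℕ) : W ⊔ LinearMap.range (z ^ t) = ⊤ := by
    induction t with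
    | zero => simp [Module.End.one_eq_id]
    | succ t ih =>
      have hrange : LinearMap.range z ≤ W ⊔ LinearMap.range (z ^ (t + 1)) := by
        rw [LinearMap.range_eq_map, ← ih, Submodule.map_sup, pow_succ', Module.End.mul_eq_comp,
          LinearMap.range_comp]
        exact sup_le_sup_right hW _
      rw [eq_top_iff, ← h]
      exact sup_le le_sup_left hrange
  obtain ⟨t, ht⟩ := hz
  simpa [ht] using sup_range_pow t

theorem span_range_pow_apply_sup_range_eq_top {x z : Module.End R V} (hxz : Commute x z) {r : ℕ}
    (hx : x ^ r = 0) {v : V}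
    (hv : Submodule.span R {v} ⊔ LinearMap.range x ⊔ LinearMap.range z = ⊤) :
    Submodule.span R (Set.range fun i : Fin r => (x ^ (i : ℕ)) v) ⊔ LinearMap.range z = ⊤ := by
  set S := Submodule.span R (Set.range fun i : Fin r => (x ^ (i : ℕ)) v) ⊔ LinearMap.range z
    with hS
  have pow_mem (i : ℕ) : (x ^ i) v ∈ S := by
    rcases lt_or_ge i r with hi | hi
    · exact Submodule.mem_sup_left (Submodule.subset_span ⟨⟨i, hi⟩, rfl⟩)
    · rw [pow_eq_zero_of_le hi hx]
      exact zero_mem S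
  refine eq_top_of_sup_range_eq_top_of_isNilpotent ⟨r, hx⟩ ?_ ?_
  · rw [hS, Submodule.map_sup, Submodule.map_span, ← LinearMap.range_comp]
    refine sup_le (Submodule.span_le.2 ?_) (le_sup_of_le_right ?_)
    · rintro _ ⟨_, ⟨i, rfl⟩, rfl⟩
      have hi := pow_mem (i + 1)
      rwa [pow_succ', Module.End.mul_apply] at hi
    · rw [show x ∘ₗ z = z ∘ₗ x from hxz.eq]
      exact LinearMap.range_comp_le_range _ _
  · rw [eq_top_iff, ← hv, sup_right_comm]
    refine sup_le_sup_right (sup_le ?_ le_sup_right) _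
    rw [Submodule.span_singleton_le_iff_mem]
    simpa using pow_mem 0

end Nakayama

section Chains

variable {F : Type*} [Field F] {m ι : Type*} [Fintype m] [DecidableEq m]

theorem sum_mul_nilBlock {k : ℕ} {f : ℕ → F} (hf : f 0 = 0) (j : Fin k) :
    ∑ i : Fin k, f (i + 1) * nilBlock F k i j = f j := by
  simp only [nilBlock, Matrix.of_apply, mul_ite, mul_one, mul_zero]
  rcases j with ⟨_ | j, hj⟩
  · simp [hf]
  · rw [Finset.sum_eq_single ⟨j, by lia⟩ (fun i _ hi => if_neg fun h => hi (Fin.ext (by grind)))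
      (by simp)]
    simp

/-- The matrix whose columns are the chains `z ^ (lam n - 1) w_n, …, z w_n, w_n`; when
invertible, it is the change of basis to a Jordan basis of `1 + z`. -/
def chainMatrix (z : Matrix m m F) (lam : ι → ℕ) (w : ι → m → F) :
    Matrix m (Σ n, Fin (lam n)) F :=
  Matrix.of fun i x => (z ^ (lam x.1 - (x.2 + 1)) *ᵥ w x.1) i

variable [Fintype ι] {z : Matrix m m F} {lam : ι → ℕ} {w : ι → m → F}

theorem mul_chainMatrix [DecidableEq ι] (hw : ∀ n, z ^ lam n *ᵥ w n = 0) :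
    z * chainMatrix z lam w =
      chainMatrix z lam w * Matrix.blockDiagonal' fun n => nilBlock F (lam n) := by
  ext i ⟨n, j⟩
  have hleft : (z * chainMatrix z lam w) i ⟨n, j⟩ = (z ^ (lam n - j) *ᵥ w n) i := by
    rw [show lam n - j = lam n - (j + 1) + 1 by lia, pow_succ', ← Matrix.mulVec_mulVec]
    rfl
  have hright := sum_mul_nilBlock (f := fun t => (z ^ (lam n - t) *ᵥ w n) i) (by simp [hw]) j
  rw [hleft, ← hright, Matrix.mul_apply, Fintype.sum_sigma, Finset.sum_eq_single n]
  · simp [chainMatrix]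
  · intro n' _ hn
    exact Finset.sum_eq_zero fun k _ => by rw [Matrix.blockDiagonal'_apply_ne _ _ _ hn, mul_zero]
  · simp

theorem mem_range_mulVecLin_chainMatrix (hw : ∀ n, z ^ lam n *ᵥ w n = 0) (n : ι) :
    w n ∈ LinearMap.range (chainMatrix z lam w).mulVecLin := by
  rw [Matrix.range_mulVecLin]
  rcases Nat.eq_zero_or_pos (lam n) with hn | hn
  · have hwn : w n = 0 := by simpa [hn] using hw n
    rw [hwn]
    exact zero_mem _
  · refine Submodule.subset_span ⟨⟨n, ⟨lam n - 1, by lia⟩⟩, ?_⟩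
    ext i
    simp [chainMatrix, Matrix.col_apply, Nat.sub_add_cancel hn]

theorem range_mulVecLin_chainMatrix (hz : IsNilpotent z) (hw : ∀ n, z ^ lam n *ᵥ w n = 0)
    (hspan : Submodule.span F (Set.range w) ⊔ LinearMap.range (Matrix.toLin' z) = ⊤) :
    LinearMap.range (chainMatrix z lam w).mulVecLin = ⊤ := by
  classical
  refine eq_top_of_sup_range_eq_top_of_isNilpotent (z := Matrix.toLin' z)
    (hz.map (Matrix.toLinAlgEquiv' (R := F))) ?_ ?_
  · rintro _ ⟨_, ⟨u, rfl⟩, rfl⟩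
    rw [Matrix.toLin'_apply, Matrix.mulVecLin_apply, Matrix.mulVec_mulVec, mul_chainMatrix hw,
      ← Matrix.mulVec_mulVec]
    exact ⟨_, rfl⟩
  · rw [eq_top_iff, ← hspan]
    refine sup_le_sup_right (Submodule.span_le.2 ?_) _
    rintro _ ⟨n, rfl⟩
    exact mem_range_mulVecLin_chainMatrix hw n

theorem matrixSimilar_blockDiagonal'_jordanBlock [DecidableEq ι] {A : Matrix m m F}
    (hA : IsNilpotent (A - 1)) (hcard : Fintype.card m = ∑ n, lam n)
    (hw : ∀ n, (A - 1) ^ lam n *ᵥ w n = 0)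
    (hspan : Submodule.span F (Set.range w) ⊔ LinearMap.range (Matrix.toLin' (A - 1)) = ⊤) :
    MatrixSimilar A (Matrix.blockDiagonal' fun n => jordanBlock F (lam n)) := by
  obtain ⟨Q, hPQ⟩ := Matrix.mulVec_surjective_iff_exists_right_inverse.1
    (LinearMap.range_eq_top.1 (range_mulVecLin_chainMatrix hA hw hspan))
  have hQP := (Matrix.mul_eq_one_comm_of_card_eq _ _ _ (by simp [hcard])).1 hPQ
  refine matrixSimilar_iff_intertwines.2 ⟨chainMatrix (A - 1) lam w, Q, hPQ, hQP, ?_⟩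
  have hAP := mul_chainMatrix hw
  rwa [← blockDiagonal'_jordanBlock_sub_one, Matrix.sub_mul, Matrix.mul_sub, Matrix.one_mul,
    Matrix.mul_one, sub_left_inj] at hAP

end Chains

section TensorProduct

theorem kronecker_pow {R : Type*} [CommSemiring R] {m n : Type*} [Fintype m] [DecidableEq m]
    [Fintype n] [DecidableEq n] (A : Matrix m m R) (B : Matrix n n R) (t : ℕ) :
    (A ⊗ₖ B) ^ t = (A ^ t) ⊗ₖ (B ^ t) := by
  induction t with
  | zero => simp only [pow_zero, Matrix.one_kronecker_one]
  | succ t ih => rw [pow_succ, ih, ← Matrix.mul_kronecker_mul, ← pow_succ, ← pow_succ]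

variable (F : Type*) [Field F] (r s : ℕ)

/-- The operator `N_r ⊗ 1`, the variable `x` of `F[x, y] / (x ^ r, y ^ s)`. -/
def tensorX : Matrix (Fin r × Fin s) (Fin r × Fin s) F :=
  nilBlock F r ⊗ₖ 1

/-- The operator `J_r ⊗ N_s`, the variable `y` of `F[x, y] / (x ^ r, y ^ s)`. The factor `J_r`,
in place of `1`, is what makes `x + y` equal to `J_r ⊗ J_s - 1`. -/
def tensorY : Matrix (Fin r × Fin s) (Fin r × Fin s) F :=
  jordanBlock F r ⊗ₖ nilBlock F s

theorem jordanBlock_kronecker_sub_one :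
    jordanBlock F r ⊗ₖ jordanBlock F s - 1 = tensorX F r s + tensorY F r s := by
  rw [tensorX, tensorY, jordanBlock, jordanBlock, Matrix.kronecker_add, Matrix.add_kronecker,
    Matrix.one_kronecker_one]
  abel

theorem tensorX_pow_eq_zero : tensorX F r s ^ r = 0 := by
  rw [tensorX, kronecker_pow, nilBlock_pow_eq_zero F le_rfl, Matrix.zero_kronecker]

theorem tensorY_pow_eq_zero : tensorY F r s ^ s = 0 := by
  rw [tensorY, kronecker_pow, nilBlock_pow_eq_zero F le_rfl, Matrix.kronecker_zero]

theorem commute_tensorX_tensorY : Commute (tensorX F r s) (tensorY F r s) := by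
  rw [Commute, SemiconjBy, tensorX, tensorY, ← Matrix.mul_kronecker_mul,
    ← Matrix.mul_kronecker_mul, jordanBlock, mul_add, add_mul, one_mul, mul_one, one_mul, mul_one]

/-- The last basis vector of `F ^ r ⊗ F ^ s`, which generates it over `F[x, y]`. -/
def cornerVector : Fin r × Fin s → F :=
  fun i => if (i.1 : ℕ) + 1 = r ∧ (i.2 : ℕ) + 1 = s then 1 else 0

variable {r s}

theorem tensorX_mulVec_single {i : Fin r} (hi : (i : ℕ) + 1 < r) (j : Fin s) :
    tensorX F r s *ᵥ Pi.single (⟨i + 1, hi⟩, j) 1 = Pi.single (i, j) 1 := by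
  ext ⟨i', j'⟩
  simp only [tensorX, Matrix.mulVec_single_one, Matrix.col_apply, Matrix.kroneckerMap_apply,
    nilBlock, Matrix.of_apply, Matrix.one_apply, Pi.single_apply, Prod.mk.injEq, Fin.ext_iff,
    ite_mul, one_mul, zero_mul, ← ite_and]
  exact if_congr (by lia) rfl rfl

theorem tensorY_mulVec_single (i : Fin r) {j : Fin s} (hj : (j : ℕ) + 1 < s) :
    tensorY F r s *ᵥ Pi.single (i, ⟨j + 1, hj⟩) 1 =
      Pi.single (i, j) 1 + tensorX F r s *ᵥ Pi.single (i, j) 1 := by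
  ext ⟨i', j'⟩
  simp only [tensorX, tensorY, jordanBlock, Matrix.mulVec_single_one, Matrix.col_apply,
    Matrix.kroneckerMap_apply, nilBlock, Matrix.of_apply, Matrix.add_apply, Matrix.one_apply,
    Pi.single_apply, Pi.add_apply, Prod.mk.injEq, Fin.ext_iff]
  split_ifs <;> first | (simp; done) | lia

theorem single_eq_cornerVector {i : Fin r} {j : Fin s} (hi : (i : ℕ) + 1 = r)
    (hj : (j : ℕ) + 1 = s) : Pi.single (i, j) 1 = cornerVector F r s := by
  ext ⟨i', j'⟩
  simp only [cornerVector, Pi.single_apply, Prod.mk.injEq, Fin.ext_iff]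
  exact if_congr (by lia) rfl rfl

variable (r s)

theorem span_cornerVector_sup_range_sup_range :
    Submodule.span F {cornerVector F r s} ⊔ LinearMap.range (Matrix.toLin' (tensorX F r s)) ⊔
      LinearMap.range (Matrix.toLin' (tensorX F r s + tensorY F r s)) = ⊤ := by
  rw [eq_top_iff, ← (Pi.basisFun F (Fin r × Fin s)).span_eq, Submodule.span_le]
  rintro _ ⟨⟨i, j⟩, rfl⟩
  rw [Pi.basisFun_apply]
  by_cases hi : (i : ℕ) + 1 < r
  · rw [← tensorX_mulVec_single F hi j]
    exact Submodule.mem_sup_left (Submodule.mem_sup_right ⟨_, rfl⟩)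
  by_cases hj : (j : ℕ) + 1 < s
  · set u : Fin r × Fin s → F := Pi.single (i, j) 1
    set v : Fin r × Fin s → F := Pi.single (i, ⟨j + 1, hj⟩) 1
    have hu : u = tensorX F r s *ᵥ (-(u + v)) + (tensorX F r s + tensorY F r s) *ᵥ v := by
      rw [Matrix.mulVec_neg, Matrix.mulVec_add, Matrix.add_mulVec, tensorY_mulVec_single F i hj]
      abel
    rw [hu]
    exact Submodule.add_mem_sup (Submodule.mem_sup_right ⟨_, rfl⟩) ⟨_, rfl⟩
  · rw [single_eq_cornerVector F (by lia) (by lia)]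
    exact Submodule.mem_sup_left (Submodule.mem_sup_left (Submodule.mem_span_singleton_self _))

end TensorProduct

section KilledLift

/-- A lift of `x ^ i` from `R / (x + y)` to `R` is killed by `(x + y) ^ L`. When `R` acts on
`J_r ⊗ J_s` by `tensorX` and `tensorY`, such a lift generates a Jordan block of size at most `L`
of the operator `x + y`. -/
def KilledLift {R : Type*} [CommRing R] (x y : R) (i L : ℕ) : Prop :=
  ∃ w, x + y ∣ x ^ i - w ∧ (x + y) ^ L * w = 0

variable (F : Type*) [Field F] (r s : ℕ)

/-- The algebra `F[tensorX, tensorY]`, a copy of `F[x, y] / (x ^ r, y ^ s)`. -/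
abbrev blockAlgebra : Subalgebra F (Matrix (Fin r × Fin s) (Fin r × Fin s) F) :=
  Algebra.adjoin F {tensorX F r s, tensorY F r s}

instance : IsMulCommutative (blockAlgebra F r s) := by
  refine Algebra.isMulCommutative_adjoin F ?_
  rintro _ (rfl | rfl) _ (rfl | rfl)
  exacts [rfl, commute_tensorX_tensorY F r s, (commute_tensorX_tensorY F r s).symm, rfl]

/-- `tensorX` as an element of the commutative ring it generates together with `tensorY`. -/
def blockX : blockAlgebra F r s :=
  ⟨tensorX F r s, Algebra.subset_adjoin (Set.mem_insert _ _)⟩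

/-- `tensorY` as an element of the commutative ring it generates together with `tensorX`. -/
def blockY : blockAlgebra F r s :=
  ⟨tensorY F r s, Algebra.subset_adjoin (Set.mem_insert_of_mem _ rfl)⟩

theorem blockX_pow_eq_zero : blockX F r s ^ r = 0 :=
  Subtype.ext (tensorX_pow_eq_zero F r s)

theorem blockY_pow_eq_zero : blockY F r s ^ s = 0 :=
  Subtype.ext (tensorY_pow_eq_zero F r s)

variable {F r s}

open scoped IsMulCommutative in
theorem IsJordanPartition.of_killedLift {lam : Finset.Icc 1 r → ℕ} (hanti : Antitone lam)
    (hpos : ∀ n, 0 < lam n) (hsum : ∑ n, lam n = r * s)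
    (hkill : ∀ n : Finset.Icc 1 r, KilledLift (blockX F r s) (blockY F r s) (n - 1) (lam n)) :
    IsJordanPartition F r s lam := by
  choose w hw hkill using hkill
  have hcomm := commute_tensorX_tensorY F r s
  have hspan := span_range_pow_apply_sup_range_eq_top
    (((Commute.refl _).add_right hcomm).map (Matrix.toLinAlgEquiv' (R := F)))
    (x := Matrix.toLin' (tensorX F r s))
    (by rw [← Matrix.toLin'_pow, tensorX_pow_eq_zero, map_zero])
    (span_cornerVector_sup_range_sup_range F r s)
  refine ⟨hanti, hpos, matrixSimilar_blockDiagonal'_jordanBlock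
    (w := fun n => (w n).val *ᵥ cornerVector F r s) ?_ (by simpa using hsum.symm) ?_ ?_⟩
  all_goals simp only [jordanBlock_kronecker_sub_one]
  · exact hcomm.isNilpotent_add ⟨r, tensorX_pow_eq_zero F r s⟩ ⟨s, tensorY_pow_eq_zero F r s⟩
  · intro n
    have hwn : (tensorX F r s + tensorY F r s) ^ lam n * (w n).val = 0 :=
      congrArg Subtype.val (hkill n)
    rw [Matrix.mulVec_mulVec, hwn, Matrix.zero_mulVec]
  · rw [eq_top_iff, ← hspan]
    refine sup_le (Submodule.span_le.2 ?_) le_sup_right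
    rintro _ ⟨i, rfl⟩
    obtain ⟨v, hv⟩ := hw ⟨i + 1, Finset.mem_Icc.2 ⟨by lia, i.2⟩⟩
    rw [Nat.add_sub_cancel, sub_eq_iff_eq_add'] at hv
    have hv' : tensorX F r s ^ (i : ℕ) = w _ + (tensorX F r s + tensorY F r s) * v :=
      congrArg Subtype.val hv
    simp only [← Matrix.toLin'_pow, Matrix.toLin'_apply, hv', Matrix.add_mulVec _ (_ * _),
      ← Matrix.mulVec_mulVec]
    exact Submodule.add_mem_sup (Submodule.subset_span ⟨_, rfl⟩) ⟨_, rfl⟩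

end KilledLift

section Congruences

variable {R : Type*} [CommRing R]

theorem dvd_add_pow_of_pow_eq_zero {a : R} {k : ℕ} (ha : a ^ k = 0) (b : R) :
    b ∣ (a + b) ^ k := by
  simpa [ha] using sub_dvd_pow_sub_pow (a + b) a k

theorem sq_dvd_add_pow_succ_of_pow_eq_zero {a : R} {k : ℕ} (ha : a ^ k = 0) (b : R) :
    b ^ 2 ∣ (a + b) ^ (k + 1) := by
  simpa [ha, pow_succ a k] using sq_dvd_add_pow_sub_sub b a (k + 1)

theorem sq_dvd_add_pow_mul_sub_of_pow_succ_eq_zero {a : R} {j : ℕ} (ha : a ^ (j + 1) = 0)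
    (b : R) : b ^ 2 ∣ (a + b) ^ j * (a - j * b) := by
  rcases j with _ | j
  · simp [show a = 0 by simpa using ha]
  · obtain ⟨c, hc⟩ := sq_dvd_add_pow_sub_sub b a (j + 1)
    rw [Nat.add_sub_cancel] at hc
    refine ⟨c * (a - (j + 1 : ℕ) * b) - (j + 1 : ℕ) ^ 2 * a ^ j, ?_⟩
    linear_combination (a - (j + 1 : ℕ) * b) * hc + ha

variable {p : ℕ} [Fact p.Prime] [CharP R p] {x y : R} {e k m : ℕ}

theorem add_pow_char_pow_add (hx : x ^ p ^ m = 0) (j : ℕ) :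
    (x + y) ^ (p ^ m + j) = y ^ p ^ m * (x + y) ^ j := by
  rw [pow_add, add_pow_char_pow, hx, zero_add]

theorem add_pow_char_pow_add_mul (hx : x ^ p ^ m = 0) (j : ℕ) :
    (x + y) ^ (p ^ m + p ^ e * j) = y ^ p ^ m * (x ^ p ^ e + y ^ p ^ e) ^ j := by
  rw [add_pow_char_pow_add hx, pow_mul (x + y), add_pow_char_pow]

end Congruences

section KilledLift

variable {R : Type*} [CommRing R] {x y : R} {s : ℕ}

-- `x ≡ -y` modulo `x + y`, so `(-y) ^ i` is a lift of `x ^ i`.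
theorem killedLift_of_dvd {i j L : ℕ} (h : y ^ j ∣ (x + y) ^ L) (hy : y ^ s = 0)
    (hs : s ≤ j + i) : KilledLift x y i L := by
  refine ⟨(-y) ^ i, by simpa using sub_dvd_pow_sub_pow x (-y) i, ?_⟩
  have hdvd : y ^ (j + i) ∣ (x + y) ^ L * (-y) ^ i := by
    rw [pow_add]
    exact mul_dvd_mul h (pow_dvd_pow_of_dvd (dvd_neg.2 dvd_rfl) i)
  rwa [pow_eq_zero_of_le hs hy, zero_dvd_iff] at hdvd

variable {p : ℕ} [Fact p.Prime] [CharP R p] {e k m i : ℕ}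

theorem killedLift_char_pow (hx : x ^ p ^ m = 0) (hy : y ^ s = 0) (hs : s ≤ p ^ m + i) :
    KilledLift x y i (p ^ m) := by
  refine killedLift_of_dvd (j := p ^ m) ?_ hy hs
  rw [add_pow_char_pow, hx, zero_add]

theorem killedLift_char_pow_add_mul (hx : x ^ (p ^ e * k) = 0) (hk : p ^ e * k ≤ p ^ m)
    (hy : y ^ s = 0) (hs : s ≤ p ^ m + p ^ e + i) :
    KilledLift x y i (p ^ m + p ^ e * k) := by
  refine killedLift_of_dvd (j := p ^ m + p ^ e) ?_ hy hs
  rw [add_pow_char_pow_add_mul (pow_eq_zero_of_le hk hx), pow_add]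
  rw [pow_mul] at hx
  exact mul_dvd_mul_left _ (dvd_add_pow_of_pow_eq_zero hx _)

theorem killedLift_char_pow_add_mul_add (hx : x ^ (p ^ e * k) = 0) (hk : p ^ e * k ≤ p ^ m)
    (hy : y ^ s = 0) (hs : s ≤ p ^ m + 2 * p ^ e + i) :
    KilledLift x y i (p ^ m + p ^ e * k + p ^ e) := by
  refine killedLift_of_dvd (j := p ^ m + 2 * p ^ e) ?_ hy hs
  rw [add_assoc, ← Nat.mul_succ, add_pow_char_pow_add_mul (pow_eq_zero_of_le hk hx), pow_add,
    mul_comm 2, pow_mul y _ 2]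
  rw [pow_mul] at hx
  exact mul_dvd_mul_left _ (sq_dvd_add_pow_succ_of_pow_eq_zero hx _)

-- The factor `x ^ p ^ e - (k - 1) * y ^ p ^ e` cancels the term of `(x + y) ^ (p ^ e * (k - 1))`
-- that is linear in `y ^ p ^ e`; modulo `x + y` it is the unit multiple `k * x ^ p ^ e`.
theorem killedLift_char_pow_add_mul_sub (hp : ¬ p ∣ k) (hx : x ^ (p ^ e * k) = 0)
    (hk : p ^ e * k ≤ p ^ m) (hy : y ^ s = 0) (hi : p ^ e ≤ i) (hs : s ≤ p ^ m + p ^ e + i) :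
    KilledLift x y i (p ^ m + p ^ e * k - p ^ e) := by
  obtain ⟨k, rfl⟩ := Nat.exists_eq_add_one_of_ne_zero (show k ≠ 0 by rintro rfl; simp at hp)
  obtain ⟨j, rfl⟩ := Nat.exists_eq_add_of_le hi
  rw [Nat.mul_succ, ← add_assoc, Nat.add_sub_cancel]
  set a := x ^ p ^ e
  set b := y ^ p ^ e
  obtain ⟨c, hc⟩ :=
    ((CharP.isUnit_natCast_iff (R := R) (Fact.out : p.Prime)).2 hp).exists_right_inv
  push_cast at hc
  have hab : x + y ∣ a + b := by
    rw [← add_pow_char_pow]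
    exact dvd_pow_self _ (pow_ne_zero _ (Fact.out : p.Prime).ne_zero)
  have hlift : x + y ∣ x ^ j - (-y) ^ j := by simpa using sub_dvd_pow_sub_pow x (-y) j
  refine ⟨c * ((a - k * b) * (-y) ^ j), ?_, ?_⟩
  · rw [pow_add, show a * x ^ j - c * ((a - k * b) * (-y) ^ j) =
      (a + b) * (c * k * x ^ j) + (x ^ j - (-y) ^ j) * (c * (a - k * b)) by
        linear_combination -(a * x ^ j) * hc]
    exact dvd_add (hab.mul_right _) (hlift.mul_right _)
  · have hsq : b ^ 2 ∣ (a + b) ^ k * (a - k * b) :=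
      sq_dvd_add_pow_mul_sub_of_pow_succ_eq_zero (by rw [← pow_mul, hx]) b
    have hdvd : y ^ (p ^ m + 2 * p ^ e + j) ∣
        y ^ p ^ m * ((a + b) ^ k * (a - k * b)) * (-y) ^ j := by
      rw [pow_add, pow_add, mul_comm 2, pow_mul y _ 2]
      exact mul_dvd_mul (mul_dvd_mul_left _ hsq) (pow_dvd_pow_of_dvd (dvd_neg.2 dvd_rfl) j)
    rw [pow_eq_zero_of_le (by lia) hy, zero_dvd_iff] at hdvd
    rw [add_pow_char_pow_add_mul (pow_eq_zero_of_le hk hx)]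
    linear_combination c * hdvd

end KilledLift

section Partitions

/-- The parts of `J_r ⊗ J_{q + b}`, for `q = p ^ m` and `b` the `p`-part of `r`. -/
def addPart (q b r n : ℕ) : ℕ :=
  if n ≤ b then q + r else q

/-- The parts of `J_r ⊗ J_{q + 2 * b}`, for `q = p ^ m` and `b` the `p`-part of `r`. -/
def addTwoPart (q b r n : ℕ) : ℕ :=
  if n ≤ b then q + r + b else if n ≤ 2 * b then q + r - b else q

/-- The parts of `J_r ⊗ J_{q + b + 1}`, for `q = p ^ m` and `b` the `p`-part of `r`. -/
def succPart (q b r n : ℕ) : ℕ :=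
  if n ≤ 1 then q + r + b else if n ≤ b then q + r else if n ≤ b + 1 then q + r - b else q

variable {q b r : ℕ}

theorem antitone_addPart : Antitone (addPart q b r) := by
  intro n n' h
  unfold addPart
  split_ifs <;> lia

theorem antitone_addTwoPart (hbr : b ≤ r) : Antitone (addTwoPart q b r) := by
  intro n n' h
  unfold addTwoPart
  split_ifs <;> lia

theorem antitone_succPart (hbr : b ≤ r) : Antitone (succPart q b r) := by
  intro n n' h
  unfold succPart
  split_ifs <;> lia

theorem addPart_pos (hq : 0 < q) (n : ℕ) : 0 < addPart q b r n := by
  unfold addPart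
  split_ifs <;> lia

theorem addTwoPart_pos (hq : 0 < q) (hbr : b ≤ r) (n : ℕ) : 0 < addTwoPart q b r n := by
  unfold addTwoPart
  split_ifs <;> lia

theorem succPart_pos (hq : 0 < q) (hbr : b ≤ r) (n : ℕ) : 0 < succPart q b r n := by
  unfold succPart
  split_ifs <;> lia

theorem isNormanPerm_addPart (hbr : b ≤ r) :
    IsNormanPerm (q + b) (fun n => addPart q b r n) (Rev r 1 b * Rev r (b + 1) r) := by
  intro n
  have := Finset.mem_Icc.1 n.2
  rw [Equiv.Perm.mul_apply, coe_Rev_apply, coe_Rev_apply]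
  unfold addPart
  split_ifs <;> lia

theorem isNormanPerm_addTwoPart (hbr : 2 * b ≤ r) :
    IsNormanPerm (q + 2 * b) (fun n => addTwoPart q b r n)
      (Rev r 1 b * Rev r (b + 1) (2 * b) * Rev r (2 * b + 1) r) := by
  intro n
  have := Finset.mem_Icc.1 n.2
  rw [Equiv.Perm.mul_apply, Equiv.Perm.mul_apply, coe_Rev_apply, coe_Rev_apply, coe_Rev_apply]
  unfold addTwoPart
  split_ifs <;> lia

theorem isNormanPerm_succPart (hb : 0 < b) (hbr : b ≤ r) :
    IsNormanPerm (q + b + 1) (fun n => succPart q b r n) (Rev r 2 b * Rev r (b + 2) r) := by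
  intro n
  have := Finset.mem_Icc.1 n.2
  rw [Equiv.Perm.mul_apply, coe_Rev_apply, coe_Rev_apply]
  unfold succPart
  split_ifs <;> lia

theorem succPart_le (n : ℕ) : succPart q b r n ≤ q + r + b := by
  unfold succPart
  split_ifs <;> lia

theorem sum_succPart {A : Type*} [AddCommMonoid A] (hb : 0 < b) (hbr : b < r) {M : ℕ}
    (hM : q + r + b ≤ M) (f : ∀ j ≤ M, A) :
    ∑ n : Finset.Icc 1 r, f (succPart q b r n) ((succPart_le n).trans hM) =
      f (q + r + b) hM + (b - 1) • f (q + r) (by lia) + f (q + r - b) (by lia) +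
        (r - b - 1) • f q (by lia) := by
  let g (n : ℕ) : A := f (succPart q b r n) ((succPart_le n).trans hM)
  have sum_Ioc {i j c : ℕ} (hc : c ≤ M) (h : ∀ n ∈ Finset.Ioc i j, succPart q b r n = c) :
      ∑ n ∈ Finset.Ioc i j, g n = (j - i) • f c hc := by
    rw [Finset.sum_congr rfl fun n hn => show g n = f c hc by simp only [g, h n hn],
      Finset.sum_const, Nat.card_Ioc]
  rw [Finset.sum_coe_sort (Finset.Icc 1 r) g,
    show Finset.Icc 1 r = Finset.Ioc 0 r from rfl,
    ← Finset.sum_Ioc_consecutive _ zero_le_one (by lia : 1 ≤ r),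
    ← Finset.sum_Ioc_consecutive _ (by lia : 1 ≤ b) hbr.le,
    ← Finset.sum_Ioc_consecutive _ (by lia : b ≤ b + 1) (by lia : b + 1 ≤ r),
    sum_Ioc hM, sum_Ioc (c := q + r) (by lia), sum_Ioc (c := q + r - b) (by lia),
    sum_Ioc (c := q) (by lia)]
  · simp [add_assoc, Nat.sub_sub]
  all_goals
    intro n hn
    rw [Finset.mem_Ioc] at hn
    unfold succPart
    split_ifs <;> lia

end Partitions

section NormanPermutations

variable (F : Type*) [Field F] {p : ℕ} [CharP F p]

theorem charP_blockAlgebra {r s : ℕ} (hr : 0 < r) (hs : 0 < s) :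
    CharP (blockAlgebra F r s) p := by
  have : Nonempty (Fin r × Fin s) := ⟨⟨⟨0, hr⟩, ⟨0, hs⟩⟩⟩
  exact (blockAlgebra F r s).val.toRingHom.charP Subtype.val_injective p

variable [Fact p.Prime] {e k m : ℕ}

open scoped IsMulCommutative in
theorem isJordanPartition_addPart (hk : 0 < k) (hkm : p ^ e * k ≤ p ^ m) :
    IsJordanPartition F (p ^ e * k) (p ^ m + p ^ e)
      (fun n => addPart (p ^ m) (p ^ e) (p ^ e * k) n) := by
  have hb := pow_pos (Fact.out : p.Prime).pos e
  have hq := pow_pos (Fact.out : p.Prime).pos m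
  have hbr := Nat.le_mul_of_pos_right (p ^ e) hk
  have := charP_blockAlgebra F (p := p) (r := p ^ e * k) (s := p ^ m + p ^ e) (by lia) (by lia)
  have hx := blockX_pow_eq_zero F (p ^ e * k) (p ^ m + p ^ e)
  have hy := blockY_pow_eq_zero F (p ^ e * k) (p ^ m + p ^ e)
  refine .of_killedLift (fun n n' h => antitone_addPart h) (fun n => addPart_pos hq n)
    (isNormanPerm_addPart hbr).sum_eq fun n => ?_
  unfold addPart
  split_ifs with hn
  · exact killedLift_char_pow_add_mul hx hkm hy (by lia)
  · exact killedLift_char_pow (pow_eq_zero_of_le hkm hx) hy (by lia)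

open scoped IsMulCommutative in
theorem isJordanPartition_addTwoPart (hpk : ¬ p ∣ k) (hk : 2 ≤ k) (hkm : p ^ e * k ≤ p ^ m) :
    IsJordanPartition F (p ^ e * k) (p ^ m + 2 * p ^ e)
      (fun n => addTwoPart (p ^ m) (p ^ e) (p ^ e * k) n) := by
  have hb := pow_pos (Fact.out : p.Prime).pos e
  have hq := pow_pos (Fact.out : p.Prime).pos m
  have hbr : 2 * p ^ e ≤ p ^ e * k := by rw [mul_comm]; exact Nat.mul_le_mul_left _ hk
  have := charP_blockAlgebra F (p := p) (r := p ^ e * k) (s := p ^ m + 2 * p ^ e)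
    (by lia) (by lia)
  have hx := blockX_pow_eq_zero F (p ^ e * k) (p ^ m + 2 * p ^ e)
  have hy := blockY_pow_eq_zero F (p ^ e * k) (p ^ m + 2 * p ^ e)
  refine .of_killedLift (fun n n' h => antitone_addTwoPart (by lia) h)
    (fun n => addTwoPart_pos hq (by lia) n) (isNormanPerm_addTwoPart hbr).sum_eq fun n => ?_
  unfold addTwoPart
  split_ifs
  · exact killedLift_char_pow_add_mul_add hx hkm hy (by lia)
  · exact killedLift_char_pow_add_mul_sub hpk hx hkm hy (by lia) (by lia)
  · exact killedLift_char_pow (pow_eq_zero_of_le hkm hx) hy (by lia)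

open scoped IsMulCommutative in
theorem isJordanPartition_succPart (hpk : ¬ p ∣ k) (hkm : p ^ e * k ≤ p ^ m) :
    IsJordanPartition F (p ^ e * k) (p ^ m + p ^ e + 1)
      (fun n => succPart (p ^ m) (p ^ e) (p ^ e * k) n) := by
  have hb := pow_pos (Fact.out : p.Prime).pos e
  have hq := pow_pos (Fact.out : p.Prime).pos m
  have hk : 0 < k := Nat.pos_of_ne_zero (by rintro rfl; simp at hpk)
  have hbr := Nat.le_mul_of_pos_right (p ^ e) hk
  have := charP_blockAlgebra F (p := p) (r := p ^ e * k) (s := p ^ m + p ^ e + 1)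
    (by lia) (by lia)
  have hx := blockX_pow_eq_zero F (p ^ e * k) (p ^ m + p ^ e + 1)
  have hy := blockY_pow_eq_zero F (p ^ e * k) (p ^ m + p ^ e + 1)
  refine .of_killedLift (fun n n' h => antitone_succPart hbr h)
    (fun n => succPart_pos hq hbr n) (isNormanPerm_succPart hb hbr).sum_eq fun n => ?_
  have hn := (Finset.mem_Icc.1 n.2).1
  unfold succPart
  split_ifs
  · exact killedLift_char_pow_add_mul_add hx hkm hy (by lia)
  · exact killedLift_char_pow_add_mul hx hkm hy (by lia)
  · exact killedLift_char_pow_add_mul_sub hpk hx hkm hy (by lia) (by lia)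
  · exact killedLift_char_pow (pow_eq_zero_of_le hkm hx) hy (by lia)

end NormanPermutations

section GreenRing

variable {F G : Type*} [Field F] [Group G]

theorem greenClass_eq_of_iso {V W : FDRep F G} (i : V ≅ W) : greenClass V = greenClass W := by
  unfold greenClass
  rw [toSkeleton_eq_toSkeleton_iff.2 ⟨i⟩]

theorem greenClass_binaryBicone_pt {V W : FDRep F G} (B : Limits.BinaryBicone V W)
    (hB : B.IsBilimit) : greenClass B.pt = greenClass V + greenClass W := by
  unfold greenClass
  rw [← map_add, ← sub_eq_zero, ← map_sub, Ideal.Quotient.eq_zero_iff_mem, ← sub_sub]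
  exact Ideal.subset_span ⟨V, W, B, ⟨hB⟩, rfl⟩

theorem greenClass_eq_zero_of_isZero {V : FDRep F G} (hV : Limits.IsZero V) :
    greenClass V = 0 := by
  have h := greenClass_binaryBicone_pt (V := V) (W := V) ⟨V, 𝟙 V, 𝟙 V, 𝟙 V, 𝟙 V,
    by simp, hV.eq_of_src _ _, hV.eq_of_src _ _, by simp⟩
    (Limits.isBinaryBilimitOfTotal _ (hV.eq_of_src _ _))
  simpa using h

section OptionBiproduct

variable {C : Type*} [Category C] [Preadditive C] [Limits.HasFiniteBiproducts C] {α : Type}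
  [Fintype α] (f : Option α → C)

/-- The decomposition of a biproduct over `Option α` into the summand at `none` and the biproduct
of the remaining ones, as a binary bicone. -/
noncomputable def optionBiproductBicone :
    Limits.BinaryBicone (f none) (⨁ fun a => f (some a)) where
  pt := ⨁ f
  fst := Limits.biproduct.π f none
  snd := Limits.biproduct.lift fun a => Limits.biproduct.π f (some a)
  inl := Limits.biproduct.ι f none
  inr := Limits.biproduct.desc fun a => Limits.biproduct.ι f (some a)
  inl_fst := by simp
  inl_snd := by
    ext a
    simp
  inr_fst := by
    ext a
    simp
  inr_snd := by
    classical
    ext a b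
    simp [Limits.biproduct.ι_π]

theorem optionBiproductBicone_total :
    (optionBiproductBicone f).fst ≫ (optionBiproductBicone f).inl +
      (optionBiproductBicone f).snd ≫ (optionBiproductBicone f).inr = 𝟙 _ := by
  change Limits.biproduct.π f none ≫ Limits.biproduct.ι f none +
    Limits.biproduct.lift (fun a => Limits.biproduct.π f (some a)) ≫
      Limits.biproduct.desc (fun a => Limits.biproduct.ι f (some a)) = 𝟙 (⨁ f)
  rw [Limits.biproduct.lift_desc, ← Limits.biproduct.total, Fintype.sum_option]

end OptionBiproduct

theorem greenClass_biproduct [Limits.HasFiniteBiproducts (FDRep F G)] {ι : Type} [Fintype ι]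
    (V : ι → FDRep F G) : greenClass (⨁ V) = ∑ n, greenClass (V n) := by
  refine Fintype.induction_empty_option
    (P := fun ι _ => ∀ V : ι → FDRep F G, greenClass (⨁ V) = ∑ n, greenClass (V n))
    (fun α β _ e ih V => ?_) (fun V => ?_) (fun α _ ih V => ?_) ι V
  · let := Fintype.ofEquiv β e.symm
    rw [← greenClass_eq_of_iso (Limits.biproduct.reindex e V), ih]
    exact e.sum_comp fun n => greenClass (V n)
  · rw [Finset.univ_eq_empty, Finset.sum_empty]
    refine greenClass_eq_zero_of_isZero ((Limits.IsZero.iff_id_eq_zero _).2 ?_)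
    ext j
    exact j.elim
  · rw [Fintype.sum_option, ← ih]
    exact greenClass_binaryBicone_pt (optionBiproductBicone V)
      (Limits.isBinaryBilimitOfTotal _ (optionBiproductBicone_total V))

theorem greenClass_bicone_pt {ι : Type} [Fintype ι] {V : ι → FDRep F G} (B : Limits.Bicone V)
    (hB : B.IsBilimit) : greenClass B.pt = ∑ n, greenClass (V n) := by
  have : Limits.HasFiniteBiproducts (FDRep F G) := Abelian.hasFiniteBiproducts
  rw [← greenClass_biproduct]
  exact greenClass_eq_of_iso (Limits.biproduct.uniqueUpToIso V hB)

end GreenRing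

section BlockInclusion

variable (F : Type*) [Field F] {ι : Type*} [DecidableEq ι] (n : ι → Type*)
  [∀ i, DecidableEq (n i)]

/-- The matrix of the inclusion of the `i`-th summand into `⨁ i, F ^ n i`; its transpose is the
matrix of the projection. -/
def blockInclusion (i : ι) : Matrix (Σ i, n i) (n i) F :=
  Matrix.of fun x a => if x = ⟨i, a⟩ then 1 else 0

theorem blockInclusion_transpose_mul_self [Fintype ι] [∀ i, Fintype (n i)] (i : ι) :
    (blockInclusion F n i)ᵀ * blockInclusion F n i = (1 ) := by
  ext a c
  simp [Matrix.mul_apply, blockInclusion, Matrix.one_apply, eq_comm]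

theorem blockInclusion_transpose_mul_of_ne [Fintype ι] [∀ i, Fintype (n i)] {i j : ι}
    (h : i ≠ j) : (blockInclusion F n j)ᵀ * blockInclusion F n i = 0 := by
  ext a c
  simp [Matrix.mul_apply, blockInclusion, h]

theorem sum_blockInclusion_mul_transpose [Fintype ι] [∀ i, Fintype (n i)] :
    ∑ i, blockInclusion F n i * (blockInclusion F n i)ᵀ = 1 := by
  ext ⟨j, a⟩ y
  rw [Matrix.sum_apply, Finset.sum_eq_single j]
  · rw [Matrix.mul_apply, Finset.sum_eq_single a]
    · simp [blockInclusion, Matrix.one_apply, eq_comm]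
    · intro c _ hc
      simp [blockInclusion, hc.symm]
    · simp
  · intro i _ hi
    simp [Matrix.mul_apply, blockInclusion, hi.symm]
  · simp

variable {F n}

theorem blockDiagonal'_mul_blockInclusion [Fintype ι] [∀ i, Fintype (n i)]
    (J : ∀ i, Matrix (n i) (n i) F) (i : ι) :
    Matrix.blockDiagonal' J * blockInclusion F n i = blockInclusion F n i * J i := by
  ext ⟨j, a⟩ c
  obtain rfl | h := eq_or_ne j i
  · simp [Matrix.mul_apply, blockInclusion, Matrix.blockDiagonal'_apply_eq]
  · simp [Matrix.mul_apply, blockInclusion, h, Matrix.blockDiagonal'_apply_ne]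

theorem blockInclusion_transpose_mul_blockDiagonal' [Fintype ι] [∀ i, Fintype (n i)]
    (J : ∀ i, Matrix (n i) (n i) F) (i : ι) :
    (blockInclusion F n i)ᵀ * Matrix.blockDiagonal' J = J i * (blockInclusion F n i)ᵀ := by
  have := blockDiagonal'_mul_blockInclusion (fun i => (J i)ᵀ) i
  rw [← Matrix.blockDiagonal'_transpose] at this
  simpa using congrArg Matrix.transpose this

end BlockInclusion

section CyclicRep

variable {F : Type*} [Field F] {q : ℕ} [NeZero q] {l m n : Type} [Fintype l] [DecidableEq l]
  [Fintype m] [DecidableEq m] [Fintype n] [DecidableEq n]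

/-- The morphism of representations of a cyclic group given by an intertwining matrix. -/
def cyclicRepHom {A : Matrix m m F} {B : Matrix n n F} (hA : A ^ q = 1) (hB : B ^ q = 1)
    (M : Matrix n m F) (hM : B * M = M * A) :
    FDRep.of (cyclicRep A hA) ⟶ FDRep.of (cyclicRep B hB) where
  hom := FGModuleCat.ofHom (Matrix.toLin' M)
  comm g := by
    apply FGModuleCat.hom_ext
    change Matrix.toLin' M ∘ₗ Matrix.toLin' (A ^ (Multiplicative.toAdd g).val) =
      Matrix.toLin' (B ^ (Multiplicative.toAdd g).val) ∘ₗ Matrix.toLin' M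
    rw [← Matrix.toLin'_mul, ← Matrix.toLin'_mul, pow_mul_eq_mul_pow_of_intertwines hM]

theorem cyclicRepHom_comp {A : Matrix l l F} {B : Matrix m m F} {C : Matrix n n F}
    (hA : A ^ q = 1) (hB : B ^ q = 1) (hC : C ^ q = 1) {M : Matrix m l F} {M' : Matrix n m F}
    (hM : B * M = M * A) (hM' : C * M' = M' * B) :
    cyclicRepHom hA hB M hM ≫ cyclicRepHom hB hC M' hM' =
      cyclicRepHom hA hC (M' * M)
        (by rw [← Matrix.mul_assoc, hM', Matrix.mul_assoc, hM, Matrix.mul_assoc]) := by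
  apply Action.Hom.ext
  apply FGModuleCat.hom_ext
  exact (Matrix.toLin'_mul _ _).symm

theorem cyclicRepHom_one {A : Matrix m m F} (hA : A ^ q = 1) :
    cyclicRepHom hA hA 1 (by rw [Matrix.one_mul, Matrix.mul_one]) = 𝟙 _ := by
  apply Action.Hom.ext
  apply FGModuleCat.hom_ext
  exact Matrix.toLin'_one

theorem cyclicRepHom_zero {A : Matrix m m F} {B : Matrix n n F} (hA : A ^ q = 1)
    (hB : B ^ q = 1) :
    cyclicRepHom hA hB 0 (by rw [Matrix.zero_mul, Matrix.mul_zero]) = 0 := by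
  apply Action.Hom.ext
  apply FGModuleCat.hom_ext
  exact map_zero Matrix.toLin'

theorem cyclicRepHom_sum {ι : Type*} (S : Finset ι) {A : Matrix m m F} {B : Matrix n n F}
    (hA : A ^ q = 1) (hB : B ^ q = 1) (M : ι → Matrix n m F) (hM : ∀ i, B * M i = M i * A) :
    cyclicRepHom hA hB (∑ i ∈ S, M i)
        (by rw [Matrix.mul_sum, Matrix.sum_mul, Finset.sum_congr rfl fun i _ => hM i]) =
      ∑ i ∈ S, cyclicRepHom hA hB (M i) (hM i) := by
  classical
  induction S using Finset.induction_on with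
  | empty => simpa only [Finset.sum_empty] using cyclicRepHom_zero hA hB
  | insert i S hi ih =>
    simp only [Finset.sum_insert hi, ← ih]
    apply Action.Hom.ext
    apply FGModuleCat.hom_ext
    exact map_add Matrix.toLin' _ _

/-- The isomorphism `F ^ m ⊗ F ^ n ≅ F ^ (m × n)`, under which `A ⊗ B` acts as the Kronecker
product. -/
noncomputable def cyclicRepTensorIso {A : Matrix m m F} {B : Matrix n n F} (hA : A ^ q = 1)
    (hB : B ^ q = 1) (hAB : (A ⊗ₖ B) ^ q = 1) :
    FDRep.of (cyclicRep A hA) ⊗ FDRep.of (cyclicRep B hB) ≅ FDRep.of (cyclicRep (A ⊗ₖ B) hAB) :=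
  Action.mkIso (LinearEquiv.toFGModuleCatIso
    ((Pi.basisFun F m).tensorProduct (Pi.basisFun F n)).equivFun) fun g => by
    apply FGModuleCat.hom_ext
    apply TensorProduct.ext'
    intro x y
    change ((Pi.basisFun F m).tensorProduct (Pi.basisFun F n)).equivFun
        (((A ^ (Multiplicative.toAdd g).val) *ᵥ x) ⊗ₜ[F]
          ((B ^ (Multiplicative.toAdd g).val) *ᵥ y)) =
      ((A ⊗ₖ B) ^ (Multiplicative.toAdd g).val) *ᵥ
        ((Pi.basisFun F m).tensorProduct (Pi.basisFun F n)).equivFun (x ⊗ₜ[F] y)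
    ext ⟨i, j⟩
    rw [kronecker_pow]
    simp only [Module.Basis.equivFun_apply, Module.Basis.tensorProduct_repr_tmul_apply,
      Pi.basisFun_repr, Matrix.mulVec, dotProduct, Matrix.kroneckerMap_apply,
      Fintype.sum_prod_type, smul_eq_mul]
    rw [mul_comm, Finset.sum_mul_sum]
    refine Finset.sum_congr rfl fun a _ => Finset.sum_congr rfl fun b _ => ?_
    ring

theorem greenClass_cyclicRep_eq_of_matrixSimilar {A : Matrix m m F} {B : Matrix n n F}
    (h : MatrixSimilar A B) (hA : A ^ q = 1) (hB : B ^ q = 1) :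
    greenClass (FDRep.of (cyclicRep A hA)) = greenClass (FDRep.of (cyclicRep B hB)) := by
  obtain ⟨P, Q, hPQ, hQP, hAP⟩ := matrixSimilar_iff_intertwines.1 h
  have hBQ : B * Q = Q * A := by
    rw [← Matrix.one_mul (B * Q), ← hQP, Matrix.mul_assoc, ← Matrix.mul_assoc P, ← hAP,
      Matrix.mul_assoc, hPQ, Matrix.mul_one]
  refine greenClass_eq_of_iso ⟨cyclicRepHom hA hB Q hBQ, cyclicRepHom hB hA P hAP, ?_, ?_⟩
  · simp only [cyclicRepHom_comp, hPQ, cyclicRepHom_one]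
  · simp only [cyclicRepHom_comp, hQP, cyclicRepHom_one]

theorem greenClass_cyclicRep_blockDiagonal' {ι : Type} [Fintype ι] [DecidableEq ι]
    {n : ι → Type} [∀ i, Fintype (n i)] [∀ i, DecidableEq (n i)] (J : ∀ i, Matrix (n i) (n i) F)
    (hJ : ∀ i, J i ^ q = 1) (hD : Matrix.blockDiagonal' J ^ q = 1) :
    greenClass (FDRep.of (cyclicRep (Matrix.blockDiagonal' J) hD)) =
      ∑ i, greenClass (FDRep.of (cyclicRep (J i) (hJ i))) := by
  have hι := blockDiagonal'_mul_blockInclusion J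
  have hπ i := (blockInclusion_transpose_mul_blockDiagonal' J i).symm
  let B : Limits.Bicone fun i => FDRep.of (cyclicRep (J i) (hJ i)) :=
    { pt := FDRep.of (cyclicRep (Matrix.blockDiagonal' J) hD)
      ι := fun i => cyclicRepHom (hJ i) hD _ (hι i)
      π := fun i => cyclicRepHom hD (hJ i) _ (hπ i)
      ι_π := fun i j => by
        rw [cyclicRepHom_comp]
        split_ifs with hij
        · subst hij
          simpa only [blockInclusion_transpose_mul_self, eqToHom_refl] using cyclicRepHom_one (hJ i)
        · simpa only [blockInclusion_transpose_mul_of_ne F n hij] using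
            cyclicRepHom_zero (hJ i) (hJ j) }
  refine greenClass_bicone_pt B (Limits.isBilimitOfTotal B ?_)
  change ∑ i, cyclicRepHom hD (hJ i) _ (hπ i) ≫ cyclicRepHom (hJ i) hD _ (hι i) = 𝟙 _
  simp only [cyclicRepHom_comp]
  rw [← cyclicRepHom_sum]
  simpa only [sum_blockInclusion_mul_transpose] using cyclicRepHom_one hD

end CyclicRep

theorem IsJordanPartition.greenClass_tensor {F : Type*} [Field F] {p : ℕ} [Fact p.Prime]
    [CharP F p] {N r s : ℕ} {lam : Finset.Icc 1 r → ℕ} (h : IsJordanPartition F r s lam)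
    (hr : r ≤ p ^ N) (hs : s ≤ p ^ N) (hlam : ∀ n, lam n ≤ p ^ N) :
    greenClass (jordanRep F r hr ⊗ jordanRep F s hs) =
      ∑ n, greenClass (jordanRep F (lam n) (hlam n)) := by
  have hlamN n : jordanBlock F (lam n) ^ p ^ N = 1 := jordanBlock_pow F (hlam n)
  have hK : (jordanBlock F r ⊗ₖ jordanBlock F s) ^ p ^ N = 1 := by
    rw [kronecker_pow, jordanBlock_pow F hr, jordanBlock_pow F hs, Matrix.one_kronecker_one]
  have hD : (Matrix.blockDiagonal' fun n => jordanBlock F (lam n)) ^ p ^ N = 1 := by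
    rw [← Matrix.blockDiagonal'_pow, ← Matrix.blockDiagonal'_one]
    exact congrArg _ (funext hlamN)
  rw [jordanRep, jordanRep, greenClass_eq_of_iso (cyclicRepTensorIso _ _ hK),
    greenClass_cyclicRep_eq_of_matrixSimilar h.2.2 hK hD,
    greenClass_cyclicRep_blockDiagonal' _ hlamN hD]
  rfl

theorem padicValNat_pow_mul_of_not_dvd {p e k : ℕ} [Fact p.Prime] (hpk : ¬ p ∣ k) :
    padicValNat p (p ^ e * k) = e := by
  have hp : p ^ e ≠ 0 := pow_ne_zero _ (Fact.out : p.Prime).ne_zero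
  rw [padicValNat.mul hp (by rintro rfl; simp at hpk), padicValNat.prime_pow,
    padicValNat.eq_zero_of_not_dvd hpk, add_zero]

/-- For `b = 1` the factor `Rev r 2 b` reverses the empty interval. -/
theorem mainTheorem9_general (p : ℕ) [Fact p.Prime] (F : Type*) [Field F] [CharP F p] (r b m : ℕ)
    (hb : b = p ^ padicValNat p r) (hbr : b < r) (hrm : r ≤ p ^ m) :
    normanPerm F r (p ^ m + b) = Rev r 1 b * Rev r (b + 1) r ∧
    (2 * b < r →
      normanPerm F r (p ^ m + 2 * b) =
        Rev r 1 b * Rev r (b + 1) (2 * b) * Rev r (2 * b + 1) r) ∧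
    normanPerm F r (p ^ m + b + 1) = Rev r 2 b * Rev r (b + 2) r ∧
    ∀ (N : ℕ) (hN : p ^ m + r + b ≤ p ^ N),
      greenClass (jordanRep F r (show r ≤ p ^ N by omega) ⊗
          jordanRep F (p ^ m + b + 1) (show p ^ m + b + 1 ≤ p ^ N by omega)) =
        greenClass (jordanRep F (p ^ m + r + b) (show p ^ m + r + b ≤ p ^ N by omega))
          + (b - 1) • greenClass (jordanRep F (p ^ m + r) (show p ^ m + r ≤ p ^ N by omega))
          + greenClass (jordanRep F (p ^ m + r - b) (show p ^ m + r - b ≤ p ^ N by omega))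
          + (r - b - 1) • greenClass (jordanRep F (p ^ m) (show p ^ m ≤ p ^ N by omega)) := by
  have hp : p.Prime := Fact.out
  obtain ⟨e, k, hpk, rfl⟩ := Nat.exists_eq_pow_mul_and_not_dvd (by lia : r ≠ 0) p hp.ne_one
  rw [padicValNat_pow_mul_of_not_dvd hpk] at hb
  subst hb
  have hb : 0 < p ^ e := pow_pos hp.pos e
  have hk2 : 2 ≤ k := (lt_mul_iff_one_lt_right hb).1 hbr
  have hsucc := isJordanPartition_succPart F hpk hrm
  refine ⟨?_, fun h2b => ?_, ?_, fun N hN => ?_⟩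
  · exact (isJordanPartition_addPart F (by lia) hrm).normanPerm_eq (isNormanPerm_addPart hbr.le)
  · exact (isJordanPartition_addTwoPart F hpk hk2 hrm).normanPerm_eq
      (isNormanPerm_addTwoPart h2b.le)
  · exact hsucc.normanPerm_eq (isNormanPerm_succPart hb hbr.le)
  · rw [hsucc.greenClass_tensor _ _ fun n => (succPart_le n).trans hN]
    exact sum_succPart hb hbr hN fun j hj => greenClass (jordanRep F j hj)

theorem mainTheorem9 (p : ℕ) [Fact p.Prime] (F : Type*) [Field F] [CharP F p] (r b m : ℕ)
    (hb : b = p ^ padicValNat p r) (hb1 : 1 < b) (hbr : b < r) (hrm : r ≤ p ^ m) :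
    normanPerm F r (p ^ m + b) = Rev r 1 b * Rev r (b + 1) r ∧
    (2 * b < r →
      normanPerm F r (p ^ m + 2 * b) =
        Rev r 1 b * Rev r (b + 1) (2 * b) * Rev r (2 * b + 1) r) ∧
    normanPerm F r (p ^ m + b + 1) = Rev r 2 b * Rev r (b + 2) r ∧
    ∀ (N : ℕ) (hN : p ^ m + r + b ≤ p ^ N),
      greenClass (jordanRep F r (show r ≤ p ^ N by omega) ⊗
          jordanRep F (p ^ m + b + 1) (show p ^ m + b + 1 ≤ p ^ N by omega)) =
        greenClass (jordanRep F (p ^ m + r + b) (show p ^ m + r + b ≤ p ^ N by omega))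
          + (b - 1) • greenClass (jordanRep F (p ^ m + r) (show p ^ m + r ≤ p ^ N by omega))
          + greenClass (jordanRep F (p ^ m + r - b) (show p ^ m + r - b ≤ p ^ N by omega))
          + (r - b - 1) • greenClass (jordanRep F (p ^ m) (show p ^ m ≤ p ^ N by omega)) :=
  mainTheorem9_general p F r b m hb hbr hrm
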